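/- Let $d\ge 2$, let $p$ satisfy $1<p<\infty$ if $d=2$ and $d-1\le p<\infty$ if $d\ge 3$, and let $\alpha:\mathbb R^{d-1}\to\mathbb R$ belong to $L^p(\mathbb R^{d-1})+L^\infty(\mathbb R^{d-1})$. Let $\tau_{\rm D}:H^1(\mathbb R^d)\to H^{1/2}(\mathbb R^{d-1})$ be the Dirichlet trace operator on the hyperplane $\mathbb R^{d-1}\times\{0\}\cong\mathbb R^{d-1}$, that is, the bounded linear operator which extends the restriction $u\mapsto u(\cdot,0)$ of Schwartz functions. Let $\mathsf A_\alpha$ be the self-adjoint operator in $L^2(\mathbb R^d)$ that represents the closed, densely defined, symmetric, semibounded form $$\mathfrak a_\alpha[u,v]=(\nabla u,\nabla v)_{L^2(\mathbb R^d;\mathbb C^d)}-\int_{\mathbb R^{d-1}}\alpha\,\tau_{\rm D}u\,\overline{\tau_{\rm D}v}\,dx,\qquad \operatorname{dom}\mathfrak a_\alpha=H^1(\mathbb R^d),$$ and, for $\lambda<0$, let $\mathsf D_{\alpha,\lambda}$ be the self-adjoint operator in $L^2(\mathbb R^{d-1})$ that represents the closed, densely defined, symmetric, semibounded form $$\mathfrak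 d_{\alpha,\lambda}[\phi,\psi]=2\big((-\Delta-\lambda)^{1/4}\phi,(-\Delta-\lambda)^{1/4}\psi\big)_{L^2(\mathbb R^{d-1})}-\int_{\mathbb R^{d-1}}\alpha\,\phi\,\overline{\psi}\,dx,\qquad \operatorname{dom}\mathfrak d_{\alpha,\lambda}=H^{1/2}(\mathbb R^{d-1}).$$ Here the operator $T$ representing a form $\mathfrak t$ is given by: $u\in\operatorname{dom}T$ and $Tu=f$ if and only if $u\in\operatorname{dom}\mathfrak t$ and $\mathfrak t[u,v]=(f,v)$ for all $v\in\operatorname{dom}\mathfrak t$. Then for every $\lambda<0$ the restriction of the Dirichlet trace operator $$\tau_{\rm D}:\ker(\mathsf A_\alpha-\lambda)\to\ker\mathsf D_{\alpha,\lambda}$$ is well defined and bijective. In particular, $\dim\ker(\mathsf A_\alpha-\lambda)=\dim\ker\mathsf D_{\alpha,\lambda}$. -/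

import Mathlib

open MeasureTheory TemperedDistribution
open scoped SchwartzMap ENNReal ComplexConjugate LineDeriv

noncomputable section

namespace DeltaHyperplane

/-- The Euclidean space `ℝⁿ`. -/
abbrev E (n : ℕ) : Type := EuclideanSpace ℝ (Fin n)

/-- The Hilbert space `L²(ℝⁿ)` of complex-valued functions. Mathlib's inner product
`inner ℂ f g` is conjugate-linear in `f` and linear in `g`. -/
abbrev L2 (n : ℕ) : Type := Lp ℂ 2 (volume : Measure (E n))

/-- The inclusion of `L²(ℝⁿ)` into the tempered distributions is injective. -/
theorem toTemperedDistribution_injective (n : ℕ) :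
    Function.Injective (Lp.toTemperedDistributionCLM ℂ (volume : Measure (E n)) 2) :=
  LinearMap.ker_eq_bot.mp Lp.ker_toTemperedDistributionCLM_eq_bot

/-! ### Sobolev spaces -/

/-- The tempered distributions which belong to `H^s(ℝⁿ)`. -/
def sobolevSubmodule (n : ℕ) (s : ℝ) : Submodule ℂ (𝓢'(E n, ℂ)) where
  carrier := {f | MemSobolev s 2 f}
  add_mem' hf hg := hf.add hg
  zero_mem' := memSobolev_fun_zero (E n) ℂ s 2
  smul_mem' c _ hf := hf.smul c

/-- The Sobolev space `H^s(ℝⁿ) = H^{s,2}(ℝⁿ)`, normed below by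
`‖f‖ = ‖(1 + |k|²)^{s/2} 𝓕 f‖_{L²}`. -/
def Sobolev (n : ℕ) (s : ℝ) : Type := sobolevSubmodule n s

namespace Sobolev

variable {n : ℕ} {s : ℝ}

instance : AddCommGroup (Sobolev n s) := inferInstanceAs (AddCommGroup (sobolevSubmodule n s))

instance : Module ℂ (Sobolev n s) := inferInstanceAs (Module ℂ (sobolevSubmodule n s))

/-- An element of `H^s(ℝⁿ)` as a tempered distribution. -/
def toDistribution : Sobolev n s →ₗ[ℂ] 𝓢'(E n, ℂ) := (sobolevSubmodule n s).subtype

theorem toDistribution_injective :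
    Function.Injective (toDistribution : Sobolev n s → 𝓢'(E n, ℂ)) :=
  Subtype.coe_injective

theorem memSobolev (f : Sobolev n s) : MemSobolev s 2 (toDistribution f) := f.2

/-- A linear operator `T` on tempered distributions that maps `H^s(ℝⁿ)` into `L²(ℝⁿ)`, viewed
as a map `H^s(ℝⁿ) → L²(ℝⁿ)`: the value at `f` is the `L²` function representing `T f`. -/
def liftL2 (T : 𝓢'(E n, ℂ) →ₗ[ℂ] 𝓢'(E n, ℂ))
    (hT : ∀ f, MemSobolev s 2 f → MemSobolev 0 2 (T f)) : Sobolev n s →ₗ[ℂ] L2 n where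
  toFun f := (memSobolev_zero_iff.mp (hT _ f.memSobolev)).choose
  map_add' f g := by
    apply toTemperedDistribution_injective
    refine Eq.trans ?_ (map_add (Lp.toTemperedDistributionCLM ℂ volume 2) _ _).symm
    refine (memSobolev_zero_iff.mp (hT _ (f + g).memSobolev)).choose_spec.symm.trans ?_
    refine ((congrArg T (map_add _ f g)).trans (map_add T _ _)).trans ?_
    exact congrArg₂ (· + ·) (memSobolev_zero_iff.mp (hT _ f.memSobolev)).choose_spec
      (memSobolev_zero_iff.mp (hT _ g.memSobolev)).choose_spec
  map_smul' c f := by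
    apply toTemperedDistribution_injective
    refine Eq.trans ?_ (map_smul (Lp.toTemperedDistributionCLM ℂ volume 2) c _).symm
    refine (memSobolev_zero_iff.mp (hT _ (c • f).memSobolev)).choose_spec.symm.trans ?_
    refine ((congrArg T (map_smul _ c f)).trans (map_smul T _ _)).trans ?_
    exact congrArg (c • ·) (memSobolev_zero_iff.mp (hT _ f.memSobolev)).choose_spec

theorem liftL2_spec (T : 𝓢'(E n, ℂ) →ₗ[ℂ] 𝓢'(E n, ℂ))
    (hT : ∀ f, MemSobolev s 2 f → MemSobolev 0 2 (T f)) (f : Sobolev n s) :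
    (Lp.toTemperedDistribution (liftL2 T hT f) : 𝓢'(E n, ℂ)) = T (toDistribution f) :=
  (memSobolev_zero_iff.mp (hT _ f.memSobolev)).choose_spec.symm

/-- The isomorphism `H^s(ℝⁿ) → L²(ℝⁿ)` given by the Bessel potential
`𝓕⁻¹ (1 + |k|²)^{s/2} 𝓕`. -/
def bessel : Sobolev n s →ₗ[ℂ] L2 n :=
  liftL2 (besselPotential (E n) ℂ s).toLinearMap fun f hf => by
    simpa using (memSobolev_besselPotential_iff (s := 0) (r := s) (p := 2) (f := f)).mpr
      (by simpa using hf)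

theorem bessel_injective : Function.Injective (bessel : Sobolev n s → L2 n) := by
  intro f g h
  have h' := congrArg (fun x : L2 n => (Lp.toTemperedDistribution x : 𝓢'(E n, ℂ))) h
  simp only [bessel, liftL2_spec, ContinuousLinearMap.coe_coe] at h'
  apply toDistribution_injective
  have := congrArg (besselPotential (E n) ℂ (-s)) h'
  simpa using this

theorem bessel_surjective : Function.Surjective (bessel : Sobolev n s → L2 n) := by
  intro g
  have hg : MemSobolev s 2 (besselPotential (E n) ℂ (-s) (Lp.toTemperedDistribution g)) := by
    rw [memSobolev_besselPotential_iff, neg_add_cancel, memSobolev_zero_iff]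
    exact ⟨g, rfl⟩
  refine ⟨(⟨_, hg⟩ : sobolevSubmodule n s), toTemperedDistribution_injective n ?_⟩
  refine (liftL2_spec _ _ _).trans ?_
  change besselPotential (E n) ℂ s (besselPotential (E n) ℂ (-s) _) = _
  simp

instance : NormedAddCommGroup (Sobolev n s) :=
  NormedAddCommGroup.induced _ _ (bessel : Sobolev n s →ₗ[ℂ] L2 n) bessel_injective

instance : NormedSpace ℂ (Sobolev n s) :=
  NormedSpace.induced ℂ _ _ (bessel : Sobolev n s →ₗ[ℂ] L2 n)

theorem norm_def (f : Sobolev n s) : ‖f‖ = ‖bessel f‖ := rfl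

instance : CompleteSpace (Sobolev n s) := by
  have hi : Isometry (bessel : Sobolev n s → L2 n) :=
    AddMonoidHomClass.isometry_of_norm _ fun f => (norm_def f).symm
  exact hi.isUniformInducing.completeSpace_congr bessel_surjective |>.mpr inferInstance

/-- The inclusion `H^s(ℝⁿ) ⊆ L²(ℝⁿ)` for `s ≥ 0`. -/
def toL2 (hs : 0 ≤ s) : Sobolev n s →ₗ[ℂ] L2 n :=
  liftL2 LinearMap.id fun _ hf => hf.mono hs

/-- Schwartz functions as elements of `H^s(ℝⁿ)`. -/
def ofSchwartz (n : ℕ) (s : ℝ) : 𝓢(E n, ℂ) →ₗ[ℂ] Sobolev n s :=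
  LinearMap.codRestrict (sobolevSubmodule n s)
    (SchwartzMap.toTemperedDistributionCLM (E n) ℂ volume).toLinearMap
    fun f => f.memSobolev

theorem toL2_ofSchwartz (hs : 0 ≤ s) (f : 𝓢(E n, ℂ)) :
    toL2 hs (ofSchwartz n s f) = f.toLp 2 := by
  apply toTemperedDistribution_injective
  simp only [Lp.toTemperedDistributionCLM_apply, toL2, liftL2_spec,
    Lp.toTemperedDistribution_toLp_eq]
  rfl

theorem toL2_injective (hs : 0 ≤ s) : Function.Injective (toL2 hs : Sobolev n s → L2 n) := by
  intro f g h
  have h' := congrArg (fun x : L2 n => (Lp.toTemperedDistribution x : 𝓢'(E n, ℂ))) h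
  simp only [toL2, liftL2_spec, LinearMap.id_apply] at h'
  exact toDistribution_injective h'

theorem denseRange_toL2 (hs : 0 ≤ s) : DenseRange (toL2 hs : Sobolev n s → L2 n) := by
  refine (SchwartzMap.denseRange_toLpCLM (F := ℂ) (E := E n) (μ := volume) (p := 2)
    ENNReal.ofNat_ne_top).mono ?_
  rintro _ ⟨f, rfl⟩
  exact ⟨ofSchwartz n s f, toL2_ofSchwartz hs f⟩

end Sobolev

/-- `H¹(ℝⁿ)`. -/
abbrev H1 (n : ℕ) : Type := Sobolev n 1

/-- `H^{1/2}(ℝⁿ)`. -/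
abbrev HHalf (n : ℕ) : Type := Sobolev n (1 / 2)

/-- The inclusion `H¹(ℝⁿ) ⊆ L²(ℝⁿ)`. -/
def H1.toL2 {n : ℕ} : H1 n →ₗ[ℂ] L2 n := Sobolev.toL2 zero_le_one

/-- The inclusion `H^{1/2}(ℝⁿ) ⊆ L²(ℝⁿ)`. -/
def HHalf.toL2 {n : ℕ} : HHalf n →ₗ[ℂ] L2 n := Sobolev.toL2 (by norm_num)

/-- The weak partial derivative `∂ᵢ : H¹(ℝⁿ) → L²(ℝⁿ)`. -/
def H1.partialDeriv {n : ℕ} (i : Fin n) : H1 n →ₗ[ℂ] L2 n :=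
  Sobolev.liftL2
    { toFun := fun f => ∂_{(EuclideanSpace.single i (1 : ℝ) : E n)} f
      map_add' := fun f g => LineDeriv.lineDerivOp_add _ f g
      map_smul' := fun c f => LineDeriv.lineDerivOp_smul _ c f }
    fun f hf => by simpa using hf.lineDerivOp (m := (EuclideanSpace.single i (1 : ℝ) : E n))

/-! ### The Dirichlet trace on the hyperplane `ℝⁿ × {0} ⊆ ℝⁿ⁺¹` -/

/-- The embedding `x ↦ (x, 0)` of `ℝⁿ` onto the hyperplane `ℝⁿ × {0} ⊆ ℝⁿ⁺¹`. -/
def hyperplaneEmbedding (n : ℕ) : E n →ₗᵢ[ℝ] E (n + 1) where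
  toFun x := WithLp.toLp 2 (Fin.snoc (α := fun _ => ℝ) x.ofLp 0)
  map_add' x y := by
    ext i
    refine Fin.lastCases ?_ (fun j => ?_) i <;> simp
  map_smul' c x := by
    ext i
    refine Fin.lastCases ?_ (fun j => ?_) i <;> simp
  norm_map' x := by
    simp [EuclideanSpace.norm_eq, Fin.sum_univ_castSucc]

/-- The restriction `f ↦ f(·, 0)` of Schwartz functions to the hyperplane. -/
def restrictHyperplane (n : ℕ) : 𝓢(E (n + 1), ℂ) →L[ℂ] 𝓢(E n, ℂ) :=
  SchwartzMap.compCLMOfAntilipschitz ℂ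
    (hyperplaneEmbedding n).toContinuousLinearMap.hasTemperateGrowth
    (hyperplaneEmbedding n).antilipschitz

theorem restrictHyperplane_apply (n : ℕ) (f : 𝓢(E (n + 1), ℂ)) (x : E n) :
    restrictHyperplane n f x = f (WithLp.toLp 2 (Fin.snoc (α := fun _ => ℝ) x.ofLp 0)) := rfl

/-- The Dirichlet trace operator `τ_D : H¹(ℝⁿ⁺¹) → H^{1/2}(ℝⁿ)`: the bounded linear operator
that extends the restriction `f ↦ f(·, 0)` of Schwartz functions. -/
def trace (n : ℕ) : H1 (n + 1) →L[ℂ] HHalf n :=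
  ((Sobolev.ofSchwartz n (1 / 2)).comp (restrictHyperplane n).toLinearMap).extendOfNorm
    (Sobolev.ofSchwartz (n + 1) 1)

/-! ### The potential term and unbounded operators -/

/-- The function `α φ ψ̄`. -/
def potentialDensity {n : ℕ} (α : E n → ℝ) (φ ψ : L2 n) : E n → ℂ :=
  fun x => (α x : ℂ) * φ x * conj (ψ x)

theorem potentialDensity_add {n : ℕ} (α : E n → ℝ) (φ₁ φ₂ ψ : L2 n) :
    potentialDensity α (φ₁ + φ₂) ψ
      =ᵐ[volume] potentialDensity α φ₁ ψ + potentialDensity α φ₂ ψ := by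
  filter_upwards [Lp.coeFn_add φ₁ φ₂] with x hx
  simp only [potentialDensity, hx, Pi.add_apply]
  ring

theorem potentialDensity_smul {n : ℕ} (α : E n → ℝ) (c : ℂ) (φ ψ : L2 n) :
    potentialDensity α (c • φ) ψ =ᵐ[volume] c • potentialDensity α φ ψ := by
  filter_upwards [Lp.coeFn_smul c φ] with x hx
  simp only [potentialDensity, hx, Pi.smul_apply, smul_eq_mul]
  ring

theorem potentialDensity_zero {n : ℕ} (α : E n → ℝ) (ψ : L2 n) :
    potentialDensity α 0 ψ =ᵐ[volume] 0 := by
  filter_upwards [Lp.coeFn_zero ℂ 2 (volume : Measure (E n))] with x hx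
  simp only [potentialDensity, hx, Pi.zero_apply, mul_zero, zero_mul]

/-- The graph of the operator that represents a form `t[u,v] = k[u,v] - ∫ α (T u) (T v)̄` with
domain `V`, where `V` is included into `L²(ℝᵐ)` by `ι`, where `T : V → L²(ℝⁿ)` and where `k` is
linear in its first variable. As in the first representation theorem, `u ∈ V` is mapped to
`f ∈ L²(ℝᵐ)` if and only if `t[u,v] = (f,v)` for all `v ∈ V`, the existence of the integral in
`t[u,v]` being understood. (This existence holds automatically if `α` is form bounded; stating it
excludes that a divergent integral is read as `0`.) -/
def formGraph {m n : ℕ} {V : Type} [AddCommGroup V] [Module ℂ V] (ι : V →ₗ[ℂ] L2 m)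
    (T : V →ₗ[ℂ] L2 n) (α : E n → ℝ) (k : V → V → ℂ) (hk : ∀ v, IsLinearMap ℂ fun u => k u v) :
    Submodule ℂ (L2 m × L2 m) where
  carrier := {z | ∃ u : V, ι u = z.1 ∧ ∀ v : V,
    Integrable (potentialDensity α (T u) (T v)) ∧
    k u v - ∫ x, potentialDensity α (T u) (T v) x = inner ℂ (ι v) z.2}
  add_mem' := by
    rintro ⟨_, f₁⟩ ⟨_, f₂⟩ ⟨u₁, rfl, h₁⟩ ⟨u₂, rfl, h₂⟩
    refine ⟨u₁ + u₂, map_add _ _ _, fun v => ?_⟩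
    obtain ⟨i₁, e₁⟩ := h₁ v
    obtain ⟨i₂, e₂⟩ := h₂ v
    have hae := potentialDensity_add α (T u₁) (T u₂) (T v)
    rw [map_add]
    refine ⟨(i₁.add i₂).congr hae.symm, ?_⟩
    rw [integral_congr_ae hae]
    simp only [Pi.add_apply]
    rw [integral_add i₁ i₂, (hk v).map_add, Prod.snd_add, inner_add_right, ← e₁, ← e₂]
    ring
  zero_mem' := by
    refine ⟨0, map_zero _, fun v => ?_⟩
    have hae := potentialDensity_zero α (T v)
    rw [map_zero]
    refine ⟨(integrable_zero _ _ _).congr hae.symm, ?_⟩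
    rw [integral_congr_ae hae]
    simp [(hk v).map_zero]
  smul_mem' := by
    rintro c ⟨_, f⟩ ⟨u, rfl, h⟩
    refine ⟨c • u, map_smul _ _ _, fun v => ?_⟩
    obtain ⟨i, e⟩ := h v
    have hae := potentialDensity_smul α c (T u) (T v)
    rw [map_smul]
    refine ⟨(i.smul c).congr hae.symm, ?_⟩
    rw [integral_congr_ae hae]
    simp only [Pi.smul_apply]
    rw [integral_smul, (hk v).map_smul, Prod.smul_snd, inner_smul_right, ← e, smul_eq_mul,
      smul_eq_mul]
    ring

/-- If the form domain is dense, then the graph is the graph of an operator. -/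
theorem formGraph_snd_eq_zero {m n : ℕ} {V : Type} [AddCommGroup V] [Module ℂ V]
    (ι : V →ₗ[ℂ] L2 m) (hι : Function.Injective ι) (hd : DenseRange ι)
    (T : V →ₗ[ℂ] L2 n) (α : E n → ℝ) (k : V → V → ℂ) (hk : ∀ v, IsLinearMap ℂ fun u => k u v)
    (z : L2 m × L2 m) (hz : z ∈ formGraph ι T α k hk) (h0 : z.1 = 0) : z.2 = 0 := by
  obtain ⟨u, hu, h⟩ := hz
  have hu0 : u = 0 := hι (by rw [hu, h0, map_zero])
  subst hu0
  have key : ∀ w : L2 m, inner ℂ w z.2 = 0 := by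
    refine fun w => hd.induction_on (p := fun w => inner ℂ w z.2 = 0) w
      (isClosed_eq (by fun_prop) continuous_const) fun v => ?_
    rw [← (h v).2, map_zero, integral_congr_ae (potentialDensity_zero α (T v))]
    simp [(hk v).map_zero]
  exact inner_self_eq_zero.mp (key z.2)

/-- The eigenspace `ker (T - μ) ⊆ L²(ℝᵐ)` of an unbounded operator `T` in `L²(ℝᵐ)`. -/
def kerSub {m : ℕ} (T : L2 m →ₗ.[ℂ] L2 m) (μ : ℂ) : Submodule ℂ (L2 m) :=
  (LinearMap.ker (T.toFun - μ • T.domain.subtype)).map T.domain.subtype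

theorem mem_kerSub_iff {m : ℕ} (T : L2 m →ₗ.[ℂ] L2 m) (μ : ℂ) (u : L2 m) :
    u ∈ kerSub T μ ↔ ∃ h : u ∈ T.domain, T ⟨u, h⟩ = μ • u := by
  simp [kerSub, sub_eq_zero]

/-! ### The Schrödinger operator with a `δ`-potential on the hyperplane -/

/-- The kinetic energy form `(∇u, ∇v)_{L²(ℝᵐ; ℂᵐ)}`, linear in `u`. -/
def gradientForm {m : ℕ} (u v : H1 m) : ℂ :=
  ∑ i, inner ℂ (H1.partialDeriv i v) (H1.partialDeriv i u)

theorem gradientForm_isLinearMap {m : ℕ} (v : H1 m) : IsLinearMap ℂ fun u => gradientForm u v where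
  map_add u₁ u₂ := by simp [gradientForm, inner_add_right, Finset.sum_add_distrib]
  map_smul c u := by simp [gradientForm, inner_smul_right, Finset.mul_sum]

/-- The operator `A_α` in `L²(ℝⁿ⁺¹)` that represents the form
`(∇u, ∇v) - ∫_{ℝⁿ} α (τ_D u) (τ_D v)̄ dx` with domain `H¹(ℝⁿ⁺¹)`. -/
def schrodingerOp (n : ℕ) (α : E n → ℝ) : L2 (n + 1) →ₗ.[ℂ] L2 (n + 1) :=
  (formGraph H1.toL2 (HHalf.toL2.comp (trace n).toLinearMap) α gradientForm
    gradientForm_isLinearMap).toLinearPMap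

theorem graph_schrodingerOp (n : ℕ) (α : E n → ℝ) :
    (schrodingerOp n α).graph = formGraph H1.toL2 (HHalf.toL2.comp (trace n).toLinearMap) α
      gradientForm gradientForm_isLinearMap :=
  Submodule.toLinearPMap_graph_eq _ fun z hz h0 =>
    formGraph_snd_eq_zero _ (Sobolev.toL2_injective _) (Sobolev.denseRange_toL2 _) _ _ _ _ z hz h0

/-! ### The relativistic Schrödinger operator -/

/-- The Fourier symbol `((2π|k|)² - lam)^{1/4}` of `(-Δ - lam)^{1/4}`; in Mathlib's normalization
of the Fourier transform, `-Δ` has the symbol `(2π|k|)²`. -/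
def quarterSymbol (n : ℕ) (lam : ℝ) (k : E n) : ℝ :=
  ((2 * Real.pi * ‖k‖) ^ 2 - lam) ^ (1 / 4 : ℝ)

theorem quarterSymbol_hasTemperateGrowth (n : ℕ) {lam : ℝ} (hlam : lam < 0) :
    Function.HasTemperateGrowth (quarterSymbol n lam) := by
  have h : quarterSymbol n lam = fun k => (-lam) ^ (1 / 4 : ℝ) *
      (1 + ‖((2 * Real.pi / √(-lam)) • ContinuousLinearMap.id ℝ (E n)) k‖ ^ 2) ^ (1 / 4 : ℝ) := by
    ext k
    rw [← Real.mul_rpow (by linarith) (by positivity), quarterSymbol]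
    congr 1
    have h1 : √(-lam) ^ 2 = -lam := Real.sq_sqrt (by linarith)
    have h2 : √(-lam) ≠ 0 := (Real.sqrt_pos.mpr (by linarith)).ne'
    simp only [smul_apply, ContinuousLinearMap.id_apply, norm_smul,
      Real.norm_eq_abs, mul_pow, sq_abs, div_pow, h1]
    have : lam ≠ 0 := hlam.ne
    field_simp
    ring
  rw [h]
  exact (Function.HasTemperateGrowth.const _).mul
    ((Function.hasTemperateGrowth_one_add_norm_sq_rpow (E n) (1 / 4)).comp
      (ContinuousLinearMap.hasTemperateGrowth _))

theorem quarterSymbol_le (n : ℕ) {lam : ℝ} (hlam : lam < 0) (k : E n) :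
    quarterSymbol n lam k ≤
      ((2 * Real.pi) ^ 2 - lam) ^ (1 / 4 : ℝ) * (1 + ‖k‖ ^ 2) ^ (1 / 4 : ℝ) := by
  have h0 : 0 ≤ (2 * Real.pi) ^ 2 - lam := by nlinarith [sq_nonneg (2 * Real.pi)]
  rw [← Real.mul_rpow h0 (by positivity), quarterSymbol]
  refine Real.rpow_le_rpow (by nlinarith [sq_nonneg (2 * Real.pi * ‖k‖)]) ?_ (by norm_num)
  nlinarith [sq_nonneg (2 * Real.pi), mul_nonneg (neg_nonneg.mpr hlam.le) (sq_nonneg ‖k‖)]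

theorem quarterSymbol_nonneg (n : ℕ) {lam : ℝ} (hlam : lam < 0) (k : E n) :
    0 ≤ quarterSymbol n lam k :=
  Real.rpow_nonneg (by nlinarith [sq_nonneg (2 * Real.pi * ‖k‖)]) _

theorem memSobolev_quarterSymbol (n : ℕ) {lam : ℝ} (hlam : lam < 0) (f : 𝓢'(E n, ℂ))
    (hf : MemSobolev (1 / 2) 2 f) :
    MemSobolev 0 2 (fourierMultiplierCLM ℂ (fun k => (quarterSymbol n lam k : ℂ)) f) := by
  have hq : Function.HasTemperateGrowth fun k => (quarterSymbol n lam k : ℂ) :=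
    Function.HasTemperateGrowth.comp Function.Complex.hasTemperateGrowth_ofReal (quarterSymbol_hasTemperateGrowth n hlam)
  have hb : Function.HasTemperateGrowth
      fun k : E n => (((1 + ‖k‖ ^ 2) ^ (-(1 / 2) / 2 : ℝ) : ℝ) : ℂ) := by fun_prop
  have hg : MemSobolev 0 2 (besselPotential (E n) ℂ (1 / 2) f) := by
    rw [memSobolev_besselPotential_iff, add_zero]
    exact hf
  have hf' : f = besselPotential (E n) ℂ (-(1 / 2)) (besselPotential (E n) ℂ (1 / 2) f) := by
    simp
  rw [hf']
  generalize besselPotential (E n) ℂ (1 / 2) f = g at hg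
  rw [besselPotential, fourierMultiplierCLM_fourierMultiplierCLM_apply hb hq]
  refine hg.fourierMultiplierCLM_of_bounded (hb.mul hq)
    ⟨((2 * Real.pi) ^ 2 - lam) ^ (1 / 4 : ℝ), fun k => ?_⟩
  have hp : (0 : ℝ) < 1 + ‖k‖ ^ 2 := by positivity
  rw [Pi.mul_apply, ← Complex.ofReal_mul, Complex.norm_real, Real.norm_eq_abs,
    abs_of_nonneg (mul_nonneg (by positivity) (quarterSymbol_nonneg n hlam k))]
  calc _ ≤ (1 + ‖k‖ ^ 2) ^ (-(1 / 2) / 2 : ℝ) *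
        (((2 * Real.pi) ^ 2 - lam) ^ (1 / 4 : ℝ) * (1 + ‖k‖ ^ 2) ^ (1 / 4 : ℝ)) := by
        gcongr
        exact quarterSymbol_le n hlam k
    _ = ((2 * Real.pi) ^ 2 - lam) ^ (1 / 4 : ℝ) *
        (1 + ‖k‖ ^ 2) ^ (-(1 / 2) / 2 + 1 / 4 : ℝ) := by
        rw [Real.rpow_add hp]
        ring
    _ = _ := by norm_num

/-- `(-Δ - lam)^{1/4} : H^{1/2}(ℝⁿ) → L²(ℝⁿ)` for `lam < 0`. -/
def quarterPower (n : ℕ) {lam : ℝ} (hlam : lam < 0) : HHalf n →ₗ[ℂ] L2 n :=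
  Sobolev.liftL2 (fourierMultiplierCLM ℂ fun k => (quarterSymbol n lam k : ℂ)).toLinearMap
    fun f hf => memSobolev_quarterSymbol n hlam f hf

/-- The kinetic energy form `2 ((-Δ - lam)^{1/4} φ, (-Δ - lam)^{1/4} ψ)_{L²(ℝⁿ)}`,
linear in `φ`. -/
def relativisticKineticForm (n : ℕ) {lam : ℝ} (hlam : lam < 0) (φ ψ : HHalf n) : ℂ :=
  2 * inner ℂ (quarterPower n hlam ψ) (quarterPower n hlam φ)

theorem relativisticKineticForm_isLinearMap (n : ℕ) {lam : ℝ} (hlam : lam < 0) (ψ : HHalf n) :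
    IsLinearMap ℂ fun φ => relativisticKineticForm n hlam φ ψ where
  map_add φ₁ φ₂ := by simp [relativisticKineticForm, inner_add_right, mul_add]
  map_smul c φ := by simp [relativisticKineticForm, inner_smul_right, mul_left_comm]

/-- The operator `D_{α,lam} = 2 (-Δ - lam)^{1/2} - α` in `L²(ℝⁿ)`, that is, the operator that
represents the form `2 ((-Δ - lam)^{1/4} φ, (-Δ - lam)^{1/4} ψ) - ∫_{ℝⁿ} α φ ψ̄ dx` with domain
`H^{1/2}(ℝⁿ)`. -/
def relativisticOp (n : ℕ) (α : E n → ℝ) {lam : ℝ} (hlam : lam < 0) : L2 n →ₗ.[ℂ] L2 n :=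
  (formGraph HHalf.toL2 HHalf.toL2 α (relativisticKineticForm n hlam)
    (relativisticKineticForm_isLinearMap n hlam)).toLinearPMap

theorem graph_relativisticOp (n : ℕ) (α : E n → ℝ) {lam : ℝ} (hlam : lam < 0) :
    (relativisticOp n α hlam).graph = formGraph HHalf.toL2 HHalf.toL2 α
      (relativisticKineticForm n hlam) (relativisticKineticForm_isLinearMap n hlam) :=
  Submodule.toLinearPMap_graph_eq _ fun z hz h0 =>
    formGraph_snd_eq_zero _ (Sobolev.toL2_injective _) (Sobolev.denseRange_toL2 _) _ _ _ _ z hz h0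

end DeltaHyperplane

end

noncomputable section

namespace DeltaHyperplane

open scoped FourierTransform

/-! ### Fourier multipliers on Sobolev spaces -/

/-! For `lam < 0` the form (∇u, ∇v) - lam (u, v) is an inner product equivalent to that of H¹.
Multiplying û by the square root of E = (2π|ξ|)² - lam carries it to the inner product of L²(ℝⁿ⁺¹);
the weight E^{1/4} on ℝⁿ does the same for H^{1/2} and the form of (-Δ - lam)^{1/4}
(`energyTransform`, `gradientForm_sub_inner`, `inner_quarterPower`).

Restricting to the hyperplane integrates the Fourier transform over the normal frequency t. In the
weighted coordinates the trace is therefore 2^{-1/2} J*, where (Jh)(k, t) = m(k, t) h(k) and ∫ m(k,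
t)² dt = 1, so that J is an isometry (`trace_eq`). Hence P = √2 J, read back in Sobolev spaces, is a
right inverse of the trace and satisfies Green's identity: the energy product of Pφ with v is the
relativistic form of φ with τv (`trace_poissonOp`, `gradientForm_poissonOp`).

If u is an eigenfunction, then w = u - Pτu has trace zero. Testing the eigenvalue equation with w
kills the potential term, so w is energy-orthogonal to u; by Green's identity it is also orthogonal
to Pτu. Thus w = 0 and u = Pτu (`poissonOp_trace`), which gives injectivity. Green's identity turns
the equation for Pφ into the equation for φ, tested with τv, and τ is onto; this gives the remaining
claims. -/

/-- Compactly supported smooth test functions suffice, since both sides are locally integrable; `b`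
may be unbounded, so `b G` is not known beforehand to be in L². -/
theorem ae_eq_mul_of_toTemperedDistribution_eq_smulLeftCLM {n : ℕ} {b : E n → ℂ}
    (hb : b.HasTemperateGrowth) {F G : L2 n}
    (h : (Lp.toTemperedDistribution F : 𝓢'(E n, ℂ)) =
      smulLeftCLM ℂ b (Lp.toTemperedDistribution G)) :
    F =ᵐ[volume] fun k => b k * G k := by
  have hbc : Continuous b := hb.1.continuous
  have hloc {F : L2 n} : LocallyIntegrable F volume :=
    (Lp.memLp F).locallyIntegrable (by norm_num)
  have hmul : LocallyIntegrable (fun k => b k * G k) volume := by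
    rw [← locallyIntegrableOn_univ]
    exact (locallyIntegrableOn_univ.mpr hloc).continuousOn_mul hbc.continuousOn
      isClosed_univ.isLocallyClosed
  refine ae_eq_of_integral_contDiff_smul_eq hloc hmul fun g hg hgc => ?_
  have hg₁ : HasCompactSupport (Complex.ofRealCLM ∘ g) := hgc.comp_left rfl
  have hg₂ : ContDiff ℝ (⊤ : ℕ∞) (Complex.ofRealCLM ∘ g) := Complex.ofRealCLM.contDiff.comp hg
  have := congrArg (fun T : 𝓢'(E n, ℂ) => T (hg₁.toSchwartzMap hg₂)) h
  simp only [smulLeftCLM_apply_apply, Lp.toTemperedDistribution_apply] at this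
  simp only [SchwartzMap.smulLeftCLM_apply_apply hb] at this
  simp only [HasCompactSupport.toSchwartzMap_toFun, Function.comp_apply,
    Complex.ofRealCLM_apply, smul_eq_mul] at this
  simp only [Complex.real_smul]
  rw [this]
  congr 1 with x
  ring

namespace Sobolev

variable {n : ℕ} {s : ℝ}

/-- The Bessel potential as an isometric isomorphism `H^s(ℝⁿ) ≃ L²(ℝⁿ)`. -/
def besselEquiv (n : ℕ) (s : ℝ) : Sobolev n s ≃ₗᵢ[ℂ] L2 n where
  __ := LinearEquiv.ofBijective bessel ⟨bessel_injective, bessel_surjective⟩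
  norm_map' f := (norm_def f).symm

theorem toTemperedDistribution_bessel (f : Sobolev n s) :
    (Lp.toTemperedDistribution (bessel f) : 𝓢'(E n, ℂ)) =
      besselPotential (E n) ℂ s (toDistribution f) := by
  rw [bessel, liftL2_spec, ContinuousLinearMap.coe_coe]

/-- The Fourier transform of an element of `H^s(ℝⁿ)` as a function. -/
def fourier (f : Sobolev n s) (k : E n) : ℂ :=
  ((1 + ‖k‖ ^ 2) ^ (-s / 2) : ℝ) * (𝓕 (bessel f) : L2 n) k

theorem fourier_toDistribution (f : Sobolev n s) :
    𝓕 (toDistribution f) = smulLeftCLM ℂ (fun k : E n => (((1 + ‖k‖ ^ 2) ^ (-s / 2) : ℝ) : ℂ))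
      (Lp.toTemperedDistribution (𝓕 (bessel f) : L2 n)) := by
  have h : toDistribution f =
      besselPotential (E n) ℂ (-s) (Lp.toTemperedDistribution (bessel f)) := by
    rw [toTemperedDistribution_bessel]
    simp
  rw [h, fourier_besselPotential_eq_smulLeftCLM_fourier_apply, Lp.fourier_toTemperedDistribution_eq]

/-- The bridge from the maps built by `liftL2`, which are known only through their distributions, to
explicit functions on the Fourier side. -/
theorem fourier_ae_eq_of_toTemperedDistribution_eq {b : E n → ℂ} (hb : b.HasTemperateGrowth)
    {F : L2 n} {f : Sobolev n s}
    (h : (Lp.toTemperedDistribution F : 𝓢'(E n, ℂ)) = fourierMultiplierCLM ℂ b (toDistribution f)) :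
    (𝓕 F : L2 n) =ᵐ[volume] fun k => b k * fourier f k := by
  have hw : Function.HasTemperateGrowth
      fun k : E n => (((1 + ‖k‖ ^ 2) ^ (-s / 2) : ℝ) : ℂ) := by fun_prop
  have h' := congrArg (fun T : 𝓢'(E n, ℂ) => 𝓕 T) h
  simp only [Lp.fourier_toTemperedDistribution_eq, TemperedDistribution.fourierMultiplierCLM_apply,
    FourierTransform.fourier_fourierInv_eq, fourier_toDistribution] at h'
  rw [smulLeftCLM_smulLeftCLM_apply hw hb] at h'
  filter_upwards [ae_eq_mul_of_toTemperedDistribution_eq_smulLeftCLM (hw.mul hb) h'] with k hk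
  rw [hk, fourier, Pi.mul_apply]
  ring

theorem fourier_toL2 (hs : 0 ≤ s) (f : Sobolev n s) :
    (𝓕 (toL2 hs f) : L2 n) =ᵐ[volume] fourier f := by
  have := fourier_ae_eq_of_toTemperedDistribution_eq (b := fun _ => 1) (F := toL2 hs f) (f := f)
    (Function.HasTemperateGrowth.const _) (by rw [toL2, liftL2_spec]; simp)
  simpa using this

theorem fourier_ofSchwartz (f : 𝓢(E n, ℂ)) :
    fourier (ofSchwartz n s f) =ᵐ[volume] (𝓕 f : 𝓢(E n, ℂ)) := by
  have := fourier_ae_eq_of_toTemperedDistribution_eq (b := fun _ => 1) (F := f.toLp 2)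
    (f := ofSchwartz n s f) (Function.HasTemperateGrowth.const _)
    (by rw [Lp.toTemperedDistribution_toLp_eq, fourierMultiplierCLM_const, one_smul]; rfl)
  rw [SchwartzMap.toLp_fourier_eq] at this
  filter_upwards [this, (𝓕 f : 𝓢(E n, ℂ)).coeFn_toLp 2 volume] with k h1 h2
  rw [← h2, h1, one_mul]

/-- The Bessel potential is an isometry onto L² and its inverse preserves Schwartz functions, so
density in L² carries over. -/
theorem denseRange_ofSchwartz (n : ℕ) (s : ℝ) : DenseRange (ofSchwartz n s) := by
  have h : DenseRange (besselEquiv n s ∘ ofSchwartz n s) := by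
    refine (SchwartzMap.denseRange_toLpCLM (F := ℂ) (E := E n) (μ := volume) (p := 2)
      ENNReal.ofNat_ne_top).mono ?_
    rintro _ ⟨f, rfl⟩
    refine ⟨SchwartzMap.fourierMultiplierCLM ℂ
      (fun k : E n => (((1 + ‖k‖ ^ 2) ^ (-s / 2) : ℝ) : ℂ)) f, ?_⟩
    apply toTemperedDistribution_injective
    refine (toTemperedDistribution_bessel _).trans
      (Eq.trans ?_ (Lp.toTemperedDistribution_toLp_eq (p := 2) f).symm)
    have h : toDistribution (ofSchwartz n s (SchwartzMap.fourierMultiplierCLM ℂ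
        (fun k : E n => (((1 + ‖k‖ ^ 2) ^ (-s / 2) : ℝ) : ℂ)) f)) =
        besselPotential (E n) ℂ (-s) (SchwartzMap.toTemperedDistributionCLM (E n) ℂ volume f) :=
      (fourierMultiplierCLM_toTemperedDistributionCLM_eq (by fun_prop) f).symm
    rw [h]
    simp
  have := (besselEquiv n s).symm.surjective.denseRange.comp h (besselEquiv n s).symm.continuous
  simpa [Function.comp_def] using this

end Sobolev

/-! ### The energy transform -/

/-- Multiplication by an essentially bounded function. -/
def mulL2 {n : ℕ} (b : E n → ℂ) (hb : MemLp b ∞ volume) : L2 n →L[ℂ] L2 n :=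
  (ContinuousLinearMap.mul ℂ ℂ).holderL volume ∞ 2 2 (hb.toLp b)

theorem coeFn_mulL2 {n : ℕ} (b : E n → ℂ) (hb : MemLp b ∞ volume) (f : L2 n) :
    mulL2 b hb f =ᵐ[volume] fun k => b k * f k := by
  filter_upwards [(ContinuousLinearMap.mul ℂ ℂ).coeFn_holder (r := 2) (hb.toLp b) f,
    hb.coeFn_toLp] with k h1 h2
  exact h1.trans (by simp [h2])

/-- Multiplication by a function that is bounded together with its inverse. -/
def mulL2Equiv {n : ℕ} (b : E n → ℂ) (hb : MemLp b ∞ volume)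
    (hb' : MemLp (fun k => (b k)⁻¹) ∞ volume) (h0 : ∀ k, b k ≠ 0) : L2 n ≃L[ℂ] L2 n :=
  ContinuousLinearEquiv.equivOfInverse (mulL2 b hb) (mulL2 _ hb')
    (fun f => by
      apply Lp.ext
      filter_upwards [coeFn_mulL2 _ hb' (mulL2 b hb f), coeFn_mulL2 b hb f] with k h1 h2
      rw [h1, h2, inv_mul_cancel_left₀ (h0 k)])
    (fun f => by
      apply Lp.ext
      filter_upwards [coeFn_mulL2 b hb (mulL2 _ hb' f), coeFn_mulL2 _ hb' f] with k h1 h2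
      rw [h1, h2, mul_inv_cancel_left₀ (h0 k)])

/-- The Fourier symbol `(2π|k|)² - lam` of `-Δ - lam`. -/
def energySymbol (n : ℕ) (lam : ℝ) (k : E n) : ℝ := (2 * Real.pi * ‖k‖) ^ 2 - lam

theorem energySymbol_pos (n : ℕ) {lam : ℝ} (hlam : lam < 0) (k : E n) :
    0 < energySymbol n lam k := by
  have := sq_nonneg (2 * Real.pi * ‖k‖)
  unfold energySymbol; linarith

theorem continuous_energySymbol (n : ℕ) (lam : ℝ) : Continuous (energySymbol n lam) := by
  unfold energySymbol; fun_prop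

theorem energySymbol_le (n : ℕ) {lam : ℝ} (hlam : lam < 0) (k : E n) :
    energySymbol n lam k ≤ ((2 * Real.pi) ^ 2 - lam) * (1 + ‖k‖ ^ 2) := by
  unfold energySymbol
  nlinarith [sq_nonneg (2 * Real.pi), mul_nonneg (neg_nonneg.mpr hlam.le) (sq_nonneg ‖k‖)]

theorem le_energySymbol (n : ℕ) {lam : ℝ} (k : E n) :
    min ((2 * Real.pi) ^ 2) (-lam) * (1 + ‖k‖ ^ 2) ≤ energySymbol n lam k := by
  have h1 := min_le_left ((2 * Real.pi) ^ 2) (-lam)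
  have h2 := min_le_right ((2 * Real.pi) ^ 2) (-lam)
  unfold energySymbol
  nlinarith [mul_le_mul_of_nonneg_right h1 (sq_nonneg ‖k‖)]

/-- The quotient of the symbols of `(-Δ - lam)^{s/2}` and of the Bessel potential of order `s`. -/
def energyRatio (n : ℕ) (lam s : ℝ) (k : E n) : ℝ :=
  (energySymbol n lam k / (1 + ‖k‖ ^ 2)) ^ (s / 2)

theorem energyRatio_inv (n : ℕ) {lam : ℝ} (hlam : lam < 0) (s : ℝ) (k : E n) :
    (energyRatio n lam s k)⁻¹ = energyRatio n lam (-s) k := by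
  have := energySymbol_pos n hlam k
  rw [energyRatio, energyRatio, neg_div, Real.rpow_neg (by positivity)]

theorem energyRatio_pos (n : ℕ) {lam : ℝ} (hlam : lam < 0) (s : ℝ) (k : E n) :
    0 < energyRatio n lam s k := by
  have := energySymbol_pos n hlam k
  rw [energyRatio]; positivity

theorem continuous_energyRatio (n : ℕ) {lam : ℝ} (hlam : lam < 0) (s : ℝ) :
    Continuous (energyRatio n lam s) := by
  have hc := continuous_energySymbol n lam
  have : ∀ k : E n, 1 + ‖k‖ ^ 2 ≠ 0 := fun k => by positivity
  refine (hc.div (by fun_prop) this).rpow_const fun k => Or.inl ?_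
  exact (div_pos (energySymbol_pos n hlam k) (by positivity)).ne'

/-- The quotient E / (1 + |k|²) stays between two positive constants, so every real power of it is
bounded. Using this for `s` and `-s` makes multiplication by the ratio invertible on L². -/
theorem memLp_energyRatio (n : ℕ) {lam : ℝ} (hlam : lam < 0) (s : ℝ) :
    MemLp (fun k : E n => (energyRatio n lam s k : ℂ)) ∞ volume := by
  set c := min ((2 * Real.pi) ^ 2) (-lam)
  set C := (2 * Real.pi) ^ 2 - lam
  have hc : 0 < c := lt_min (by positivity) (by linarith)
  refine memLp_top_of_bound (Complex.continuous_ofReal.comp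
    (continuous_energyRatio n hlam s)).aestronglyMeasurable (max (C ^ (s / 2)) (c ^ (s / 2)))
    (.of_forall fun k => ?_)
  rw [Complex.norm_real, Real.norm_of_nonneg (energyRatio_pos n hlam s k).le, energyRatio]
  have hp : 0 < 1 + ‖k‖ ^ 2 := by positivity
  have h1 : c ≤ energySymbol n lam k / (1 + ‖k‖ ^ 2) := (le_div_iff₀ hp).mpr (le_energySymbol n k)
  have h2 : energySymbol n lam k / (1 + ‖k‖ ^ 2) ≤ C :=
    (div_le_iff₀ hp).mpr (energySymbol_le n hlam k)
  rcases le_total 0 (s / 2) with hs | hs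
  · exact (Real.rpow_le_rpow (hc.le.trans h1) h2 hs).trans (le_max_left _ _)
  · exact (Real.rpow_le_rpow_of_nonpos hc h1 hs).trans (le_max_right _ _)

/-- The isomorphism `f ↦ ((2π|k|)² - lam)^{s/2} 𝓕 f` of `H^s(ℝⁿ)` onto `L²(ℝⁿ)`. -/
def energyTransform (n : ℕ) {lam : ℝ} (hlam : lam < 0) (s : ℝ) : Sobolev n s ≃L[ℂ] L2 n :=
  ((Sobolev.besselEquiv n s).trans (Lp.fourierTransformₗᵢ (E n) ℂ)).toContinuousLinearEquiv.trans
    (mulL2Equiv (fun k => (energyRatio n lam s k : ℂ)) (memLp_energyRatio n hlam s)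
      (by simpa only [← Complex.ofReal_inv, energyRatio_inv n hlam] using
        memLp_energyRatio n hlam (-s))
      fun k => Complex.ofReal_ne_zero.mpr (energyRatio_pos n hlam s k).ne')

theorem coeFn_energyTransform (n : ℕ) {lam : ℝ} (hlam : lam < 0) (s : ℝ) (f : Sobolev n s) :
    energyTransform n hlam s f =ᵐ[volume]
      fun k => ((energySymbol n lam k ^ (s / 2) : ℝ) : ℂ) * Sobolev.fourier f k := by
  filter_upwards [coeFn_mulL2 _ (memLp_energyRatio n hlam s) (𝓕 (Sobolev.bessel f))] with k hk
  refine hk.trans ?_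
  have := energySymbol_pos n hlam k
  rw [Sobolev.fourier, ← mul_assoc, ← Complex.ofReal_mul, energyRatio,
    Real.div_rpow this.le (by positivity), neg_div, Real.rpow_neg (by positivity), div_eq_mul_inv]

theorem inner_quarterPower (n : ℕ) {lam : ℝ} (hlam : lam < 0) (φ ψ : HHalf n) :
    inner ℂ (quarterPower n hlam ψ) (quarterPower n hlam φ) =
      inner ℂ (energyTransform n hlam (1 / 2) ψ) (energyTransform n hlam (1 / 2) φ) := by
  have h (φ : HHalf n) : 𝓕 (quarterPower n hlam φ) = energyTransform n hlam (1 / 2) φ := by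
    have hq : Function.HasTemperateGrowth fun k => (quarterSymbol n lam k : ℂ) :=
      Function.HasTemperateGrowth.comp Function.Complex.hasTemperateGrowth_ofReal
        (quarterSymbol_hasTemperateGrowth n hlam)
    apply Lp.ext
    filter_upwards [coeFn_energyTransform n hlam (1 / 2) φ,
      Sobolev.fourier_ae_eq_of_toTemperedDistribution_eq hq
        (Sobolev.liftL2_spec _ (fun f hf => memSobolev_quarterSymbol n hlam f hf) φ)] with k h1 h2
    rw [h1, ← show (1 / 4 : ℝ) = 1 / 2 / 2 by norm_num]
    exact h2
  rw [← h, ← h, Lp.inner_fourier_eq]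

theorem H1.fourier_partialDeriv {n : ℕ} (i : Fin n) (u : H1 n) :
    (𝓕 (H1.partialDeriv i u) : L2 n) =ᵐ[volume]
      fun k => (2 * Real.pi * Complex.I * (k i : ℂ)) * Sobolev.fourier u k := by
  have hi : Function.HasTemperateGrowth fun k : E n =>
      ((inner ℝ k (EuclideanSpace.single i (1 : ℝ)) : ℝ) : ℂ) := by fun_prop
  have := Sobolev.fourier_ae_eq_of_toTemperedDistribution_eq (F := H1.partialDeriv i u) (f := u)
    (b := (2 * Real.pi * Complex.I) • fun k : E n =>
      ((inner ℝ k (EuclideanSpace.single i (1 : ℝ)) : ℝ) : ℂ))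
    ((Function.HasTemperateGrowth.const (2 * Real.pi * Complex.I : ℂ)).mul hi) (by
      rw [H1.partialDeriv, Sobolev.liftL2_spec, fourierMultiplierCLM_smul hi]
      exact lineDeriv_eq_fourierMultiplierCLM _ _)
  filter_upwards [this] with k hk
  rw [hk]
  simp [EuclideanSpace.inner_single_right]

/-- Plancherel: the symbols of the partial derivatives satisfy ∑ |2πi kᵢ|² - lam = E. -/
theorem gradientForm_sub_inner {n : ℕ} {lam : ℝ} (hlam : lam < 0) (u v : H1 n) :
    gradientForm u v - inner ℂ (H1.toL2 v) ((lam : ℂ) • H1.toL2 u) =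
      inner ℂ (energyTransform n hlam 1 v) (energyTransform n hlam 1 u) := by
  rw [gradientForm, Finset.sum_congr rfl fun i _ => (Lp.inner_fourier_eq _ _).symm,
    inner_smul_right, ← Lp.inner_fourier_eq]
  simp only [L2.inner_def]
  rw [← integral_finsetSum _ fun i _ => L2.integrable_inner _ _, ← integral_const_mul,
    ← integral_sub (integrable_finsetSum _ fun i _ => L2.integrable_inner _ _)
      ((L2.integrable_inner _ _).const_mul _)]
  refine integral_congr_ae ?_
  filter_upwards [coeFn_energyTransform n hlam 1 u, coeFn_energyTransform n hlam 1 v,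
    Sobolev.fourier_toL2 zero_le_one u, Sobolev.fourier_toL2 zero_le_one v,
    ae_all_iff.mpr fun i => H1.fourier_partialDeriv i u,
    ae_all_iff.mpr fun i => H1.fourier_partialDeriv i v] with k h1 h2 h3 h4 h5 h6
  have hE := energySymbol_pos n hlam k
  have hsq : (energySymbol n lam k ^ (1 / 2 : ℝ)) ^ 2 = energySymbol n lam k := by
    rw [← Real.sqrt_eq_rpow, Real.sq_sqrt hE.le]
  have hsum : (energySymbol n lam k : ℂ) = ∑ i, (2 * Real.pi * (k i : ℂ)) ^ 2 - lam := by
    rw [energySymbol, mul_pow, EuclideanSpace.real_norm_sq_eq]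
    push_cast
    simp only [mul_pow, Finset.mul_sum]
  simp only [h1, h2, h5, h6, H1.toL2, h3, h4, RCLike.inner_apply, map_mul, Complex.conj_ofReal,
    Complex.conj_I, map_ofNat]
  generalize Sobolev.fourier u k = a
  generalize Sobolev.fourier v k = b
  rw [show ∀ r : ℂ, r * a * (r * conj b) = r ^ 2 * (a * conj b) from fun r => by ring,
    ← Complex.ofReal_pow, hsq, hsum, sub_mul, Finset.sum_mul]
  congr 1
  refine Finset.sum_congr rfl fun i _ => ?_
  linear_combination (-(2 * Real.pi * (k i : ℂ)) ^ 2 * (a * conj b)) * Complex.I_sq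

/-! ### The splitting `ℝⁿ⁺¹ = ℝⁿ × ℝ` -/

/-- The splitting `ℝⁿ × ℝ = ℝⁿ⁺¹`. -/
def hyperplaneSplit (n : ℕ) : E n × ℝ ≃ᵐ E (n + 1) :=
  -- `piFinSuccAbove` places the singled-out coordinate first, hence the swap.
  (MeasurableEquiv.prodComm.trans
    ((MeasurableEquiv.refl ℝ).prodCongr (MeasurableEquiv.toLp 2 (Fin n → ℝ)).symm)).trans
    ((MeasurableEquiv.piFinSuccAbove (fun _ : Fin (n + 1) => ℝ) (Fin.last n)).symm.trans
      (MeasurableEquiv.toLp 2 (Fin (n + 1) → ℝ)))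

theorem hyperplaneSplit_apply (n : ℕ) (z : E n × ℝ) :
    hyperplaneSplit n z = WithLp.toLp 2 (Fin.snoc (α := fun _ => ℝ) z.1.ofLp z.2) := by
  have : hyperplaneSplit n z =
    WithLp.toLp 2 ((Fin.last n).insertNth (α := fun _ => ℝ) z.2 z.1.ofLp) := rfl
  rw [this, Fin.insertNth_last']

theorem measurePreserving_hyperplaneSplit (n : ℕ) :
    MeasurePreserving (hyperplaneSplit n) (volume.prod volume) volume := by
  refine MeasurePreserving.trans (μb := (volume : Measure ℝ).prod (volume : Measure (Fin n → ℝ)))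
    (MeasurePreserving.trans (μb := (volume : Measure ℝ).prod (volume : Measure (E n)))
      Measure.measurePreserving_swap
      ((MeasurePreserving.id _).prod (PiLp.volume_preserving_ofLp (Fin n))))
    (MeasurePreserving.trans (μb := (volume : Measure (Fin (n + 1) → ℝ)))
      ((volume_preserving_piFinSuccAbove (fun _ : Fin (n + 1) => ℝ) (Fin.last n)).symm _)
      (PiLp.volume_preserving_toLp (Fin (n + 1))))

theorem norm_hyperplaneSplit_sq (n : ℕ) (z : E n × ℝ) :
    ‖hyperplaneSplit n z‖ ^ 2 = ‖z.1‖ ^ 2 + z.2 ^ 2 := by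
  simp [hyperplaneSplit_apply, EuclideanSpace.real_norm_sq_eq, Fin.sum_univ_castSucc]

theorem inner_hyperplaneSplit (n : ℕ) (z : E n × ℝ) (x : E n) :
    inner ℝ (hyperplaneSplit n z) (hyperplaneSplit n (x, 0)) = inner ℝ z.1 x := by
  simp [hyperplaneSplit_apply, PiLp.inner_apply, Fin.sum_univ_castSucc]

theorem continuous_hyperplaneSplit (n : ℕ) : Continuous (hyperplaneSplit n) := by
  have h : Continuous fun z : E n × ℝ =>
      (WithLp.toLp 2 (Fin.snoc (α := fun _ => ℝ) z.1.ofLp z.2) : E (n + 1)) := by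
    refine (PiLp.continuous_toLp 2 _).comp (continuous_pi fun i => ?_)
    refine Fin.lastCases ?_ (fun j => ?_) i
    · simpa using continuous_snd
    · simp only [Fin.snoc_castSucc]
      fun_prop
  exact h.congr fun z => (hyperplaneSplit_apply n z).symm

theorem integral_hyperplaneSplit {n : ℕ} {g : E (n + 1) → ℂ} (hg : Integrable g) :
    ∫ ξ, g ξ = ∫ k, ∫ t, g (hyperplaneSplit n (k, t)) := by
  rw [← (measurePreserving_hyperplaneSplit n).integral_comp', integral_prod]
  exact (measurePreserving_hyperplaneSplit n).integrable_comp_emb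
    (hyperplaneSplit n).measurableEmbedding |>.mpr hg

theorem lintegral_hyperplaneSplit {n : ℕ} {g : E (n + 1) → ℝ≥0∞} (hg : AEMeasurable g) :
    ∫⁻ ξ, g ξ = ∫⁻ k, ∫⁻ t, g (hyperplaneSplit n (k, t)) := by
  rw [← (measurePreserving_hyperplaneSplit n).lintegral_comp_emb
    (hyperplaneSplit n).measurableEmbedding, lintegral_prod]
  exact hg.comp_quasiMeasurePreserving (measurePreserving_hyperplaneSplit n).quasiMeasurePreserving

/-! ### The Fourier transform of the restriction to the hyperplane -/

/-- The bound is uniform in `k` and integrable in `t`, as dominated convergence requires. -/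
theorem norm_schwartz_hyperplaneSplit_le {n : ℕ} (g : 𝓢(E (n + 1), ℂ)) :
    ∃ C : ℝ, ∀ k t, ‖g (hyperplaneSplit n (k, t))‖ ≤ C * (1 + t ^ 2)⁻¹ := by
  obtain ⟨C₀, -, h₀⟩ := g.decay 0 0
  obtain ⟨C₂, -, h₂⟩ := g.decay 2 0
  refine ⟨C₀ + C₂, fun k t => ?_⟩
  rw [← div_eq_mul_inv, le_div_iff₀ (by positivity)]
  have e₀ := h₀ (hyperplaneSplit n (k, t))
  have e₂ := h₂ (hyperplaneSplit n (k, t))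
  rw [norm_iteratedFDeriv_zero] at e₀ e₂
  rw [norm_hyperplaneSplit_sq] at e₂
  nlinarith [mul_nonneg (sq_nonneg ‖k‖) (norm_nonneg (g (hyperplaneSplit n (k, t))))]

theorem continuous_integral_schwartz_hyperplaneSplit {n : ℕ} (g : 𝓢(E (n + 1), ℂ)) :
    Continuous fun k => ∫ t, g (hyperplaneSplit n (k, t)) := by
  obtain ⟨C, hC⟩ := norm_schwartz_hyperplaneSplit_le g
  have hc := g.continuous.comp (continuous_hyperplaneSplit n)
  refine continuous_of_dominated (bound := fun t => C * (1 + t ^ 2)⁻¹) (fun k => ?_)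
    (fun k => .of_forall (hC k)) (integrable_inv_one_add_sq.const_mul C) (.of_forall fun t => ?_)
  · exact (hc.comp (by fun_prop : Continuous fun t : ℝ => (k, t))).aestronglyMeasurable
  · exact hc.comp (by fun_prop : Continuous fun k : E n => (k, t))

/-- Fourier inversion at (x, 0) followed by Fubini: the character does not depend on the normal
frequency `t`. -/
theorem restrictHyperplane_eq_fourierInv {n : ℕ} (f : 𝓢(E (n + 1), ℂ)) :
    (restrictHyperplane n f : E n → ℂ) =
      𝓕⁻ fun k => ∫ t, (𝓕 f : 𝓢(E (n + 1), ℂ)) (hyperplaneSplit n (k, t)) := by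
  ext x
  set g := (𝓕 f : 𝓢(E (n + 1), ℂ)) with hg
  have h1 : f = 𝓕⁻ g := (FourierTransform.fourierInv_fourier_eq f).symm
  have h2 : restrictHyperplane n f x = f (hyperplaneSplit n (x, 0)) := by
    rw [restrictHyperplane_apply, hyperplaneSplit_apply]
  have hint : Integrable fun ξ : E (n + 1) =>
      Real.fourierChar (inner ℝ ξ (hyperplaneSplit n (x, 0))) • g ξ := by
    have := (Real.fourierIntegral_convergent_iff (V := E (n + 1)) (f := g) (μ := volume)
      (-hyperplaneSplit n (x, 0))).mpr g.integrable
    simpa using this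
  rw [h2, h1, SchwartzMap.fourierInv_coe, Real.fourierInv_eq, Real.fourierInv_eq,
    integral_hyperplaneSplit hint]
  refine integral_congr_ae (.of_forall fun k => ?_)
  simp only [inner_hyperplaneSplit]
  simp only [Circle.smul_def]
  exact integral_smul _ _

theorem fourier_restrictHyperplane {n : ℕ} (f : 𝓢(E (n + 1), ℂ)) (k : E n) :
    (𝓕 (restrictHyperplane n f) : 𝓢(E n, ℂ)) k =
      ∫ t, (𝓕 f : 𝓢(E (n + 1), ℂ)) (hyperplaneSplit n (k, t)) := by
  set G : E n → ℂ := fun k => ∫ t, (𝓕 f : 𝓢(E (n + 1), ℂ)) (hyperplaneSplit n (k, t)) with hG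
  have hGc : Continuous G := continuous_integral_schwartz_hyperplaneSplit _
  have hGi : Integrable G :=
    ((measurePreserving_hyperplaneSplit n).integrable_comp_emb
      (hyperplaneSplit n).measurableEmbedding |>.mpr
        (𝓕 f : 𝓢(E (n + 1), ℂ)).integrable).integral_prod_left
  have hr : (restrictHyperplane n f : E n → ℂ) = 𝓕⁻ G := restrictHyperplane_eq_fourierInv f
  -- `𝓕 G` is the reflection of `𝓕⁻ G`, which is a Schwartz function by `hr`. Pointwise inversion
  -- then applies, `G` being continuous and integrable.
  have hGF : Integrable (𝓕 G) := by
    have : Integrable (𝓕⁻ G) := hr ▸ (restrictHyperplane n f).integrable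
    rw [show 𝓕 G = fun w => 𝓕⁻ G (-w) from funext fun w => by
      rw [Real.fourierInv_eq_fourier_neg, neg_neg]]
    exact this.comp_neg
  rw [SchwartzMap.fourier_coe, hr, hGc.fourier_fourierInv_eq hGi hGF]

/-! ### The isometry of `L²(ℝⁿ)` into `L²(ℝⁿ⁺¹)` that is adjoint to the trace -/

theorem energySymbol_hyperplaneSplit (n : ℕ) (lam : ℝ) (z : E n × ℝ) :
    energySymbol (n + 1) lam (hyperplaneSplit n z) =
      energySymbol n lam z.1 + (2 * Real.pi * z.2) ^ 2 := by
  rw [energySymbol, energySymbol, mul_pow, norm_hyperplaneSplit_sq]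
  ring

/-- The function `√2 ((2π|k|)² - lam)^{1/4} / ((2π|k|)² + (2πt)² - lam)^{1/2}` of
`(k, t) ∈ ℝⁿ × ℝ`. -/
def poissonKernel (n : ℕ) (lam : ℝ) (ξ : E (n + 1)) : ℝ :=
  √2 * energySymbol n lam ((hyperplaneSplit n).symm ξ).1 ^ (1 / 4 : ℝ) *
    (energySymbol (n + 1) lam ξ ^ (1 / 2 : ℝ))⁻¹

theorem measurable_poissonKernel (n : ℕ) (lam : ℝ) : Measurable (poissonKernel n lam) := by
  have h1 := (continuous_energySymbol n lam).measurable
  have h2 := (continuous_energySymbol (n + 1) lam).measurable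
  have h3 := (hyperplaneSplit n).symm.measurable.fst
  exact (((h1.comp h3).pow_const _).const_mul _).mul (h2.pow_const _).inv

theorem poissonKernel_hyperplaneSplit_sq (n : ℕ) {lam : ℝ} (hlam : lam < 0) (k : E n) (t : ℝ) :
    poissonKernel n lam (hyperplaneSplit n (k, t)) ^ 2 =
      2 / √(energySymbol n lam k) *
        (1 + (2 * Real.pi / √(energySymbol n lam k) * t) ^ 2)⁻¹ := by
  have h0 := energySymbol_pos n hlam k
  have h1 : 0 < √(energySymbol n lam k) := Real.sqrt_pos.mpr h0
  have h2 : √(energySymbol n lam k) ^ 2 = energySymbol n lam k := Real.sq_sqrt h0.le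
  have h3 : 0 < energySymbol n lam k + (2 * Real.pi * t) ^ 2 := by positivity
  rw [poissonKernel, MeasurableEquiv.symm_apply_apply, energySymbol_hyperplaneSplit, mul_pow,
    mul_pow, inv_pow, Real.sq_sqrt zero_le_two, ← Real.sqrt_eq_rpow, Real.sq_sqrt h3.le,
    ← Real.rpow_mul_natCast h0.le, show (1 / 4 : ℝ) * (2 : ℕ) = 1 / 2 by norm_num,
    ← Real.sqrt_eq_rpow]
  generalize √(energySymbol n lam k) = a at *
  rw [← h2] at h3 ⊢
  have : a ^ 2 + (2 * Real.pi * t) ^ 2 ≠ 0 := h3.ne'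
  have h4 : 1 + (2 * Real.pi / a * t) ^ 2 = (a ^ 2 + (2 * Real.pi * t) ^ 2) / a ^ 2 := by
    field_simp
  rw [h4]
  field_simp

/-- The square is a rescaled Cauchy density: ∫ (1 + (ct)²)⁻¹ dt = π / c with c = 2π / √E. The factor
√2 in `poissonKernel` is what makes the total exactly 1. -/
theorem lintegral_poissonKernel_sq (n : ℕ) {lam : ℝ} (hlam : lam < 0) (k : E n) :
    ∫⁻ t, ‖poissonKernel n lam (hyperplaneSplit n (k, t))‖ₑ ^ 2 = 1 := by
  have h0 : 0 < √(energySymbol n lam k) := Real.sqrt_pos.mpr (energySymbol_pos n hlam k)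
  have hc : 0 < 2 * Real.pi / √(energySymbol n lam k) := by positivity
  have h1 (t : ℝ) : ‖poissonKernel n lam (hyperplaneSplit n (k, t))‖ₑ ^ 2 =
      ENNReal.ofReal (2 / √(energySymbol n lam k) *
        (1 + (2 * Real.pi / √(energySymbol n lam k) * t) ^ 2)⁻¹) := by
    rw [← poissonKernel_hyperplaneSplit_sq n hlam, ← sq_abs, ← Real.norm_eq_abs,
      ENNReal.ofReal_pow (norm_nonneg _), ofReal_norm]
  simp_rw [h1]
  rw [← ofReal_integral_eq_lintegral_ofReal
    ((integrable_inv_one_add_sq.comp_mul_left' hc.ne').const_mul _)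
    (.of_forall fun t => by positivity), integral_const_mul,
    Measure.integral_comp_mul_left (fun t : ℝ => (1 + t ^ 2)⁻¹), integral_univ_inv_one_add_sq,
    abs_of_pos (by positivity), smul_eq_mul, ← ENNReal.ofReal_one]
  congr 1
  have := Real.pi_pos
  field_simp

theorem quasiMeasurePreserving_fst_hyperplaneSplit_symm (n : ℕ) :
    Measure.QuasiMeasurePreserving (fun ξ => ((hyperplaneSplit n).symm ξ).1) volume volume :=
  Measure.quasiMeasurePreserving_fst.comp
    ((measurePreserving_hyperplaneSplit n).symm _).quasiMeasurePreserving

theorem aestronglyMeasurable_poissonKernel_mul (n : ℕ) (lam : ℝ) {h : E n → ℂ}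
    (hh : AEStronglyMeasurable h) :
    AEStronglyMeasurable
      fun ξ => (poissonKernel n lam ξ : ℂ) * h ((hyperplaneSplit n).symm ξ).1 :=
  (Complex.measurable_ofReal.comp
    (measurable_poissonKernel n lam)).aestronglyMeasurable.mul
    (hh.comp_quasiMeasurePreserving (quasiMeasurePreserving_fst_hyperplaneSplit_symm n))

/-- By Tonelli, since each fibre over `k` contributes |h(k)|² times a unit integral. -/
theorem eLpNorm_poissonKernel_mul (n : ℕ) {lam : ℝ} (hlam : lam < 0) {h : E n → ℂ}
    (hh : AEStronglyMeasurable h) :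
    eLpNorm (fun ξ => (poissonKernel n lam ξ : ℂ) * h ((hyperplaneSplit n).symm ξ).1) 2 volume =
      eLpNorm h 2 volume := by
  have hm := aestronglyMeasurable_poissonKernel_mul n lam hh
  rw [eLpNorm_eq_lintegral_rpow_enorm_toReal two_ne_zero ENNReal.ofNat_ne_top,
    eLpNorm_eq_lintegral_rpow_enorm_toReal two_ne_zero ENNReal.ofNat_ne_top]
  simp only [ENNReal.toReal_ofNat, ENNReal.rpow_ofNat]
  congr 1
  rw [lintegral_hyperplaneSplit (hm.enorm.pow_const 2)]
  refine lintegral_congr fun k => ?_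
  simp only [MeasurableEquiv.symm_apply_apply, enorm_mul, mul_pow]
  have hk : Measurable fun t =>
      ‖((poissonKernel n lam (hyperplaneSplit n (k, t)) : ℝ) : ℂ)‖ₑ ^ 2 := by
    have h1 := (Complex.measurable_ofReal.comp (measurable_poissonKernel n lam)).comp
      ((hyperplaneSplit n).measurable.comp (measurable_prodMk_left (x := k) (β := ℝ)))
    exact h1.enorm.pow_const 2
  rw [lintegral_mul_const _ hk]
  have h2 (r : ℝ) : ‖(r : ℂ)‖ₑ = ‖r‖ₑ := by
    rw [← ofReal_norm, ← ofReal_norm, Complex.norm_real]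
  simp_rw [h2]
  rw [lintegral_poissonKernel_sq n hlam, one_mul]

theorem memLp_poissonKernel_mul (n : ℕ) {lam : ℝ} (hlam : lam < 0) {h : E n → ℂ}
    (hh : MemLp h 2) :
    MemLp (fun ξ => (poissonKernel n lam ξ : ℂ) * h ((hyperplaneSplit n).symm ξ).1) 2 volume :=
  ⟨aestronglyMeasurable_poissonKernel_mul n lam hh.1,
    (eLpNorm_poissonKernel_mul n hlam hh.1).trans_lt hh.2⟩

/-- The isometry `h ↦ ((k, t) ↦ m(k, t) h(k))` of `L²(ℝⁿ)` into `L²(ℝⁿ⁺¹)`, where `m` is the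
`poissonKernel`. -/
def poissonIsometry (n : ℕ) {lam : ℝ} (hlam : lam < 0) : L2 n →ₗᵢ[ℂ] L2 (n + 1) where
  toFun h := MemLp.toLp
    (fun ξ => (poissonKernel n lam ξ : ℂ) * h ((hyperplaneSplit n).symm ξ).1)
    (memLp_poissonKernel_mul n hlam (Lp.memLp h))
  map_add' h₁ h₂ := by
    rw [← MemLp.toLp_add]
    refine MemLp.toLp_congr _ _ ?_
    filter_upwards [(quasiMeasurePreserving_fst_hyperplaneSplit_symm n).ae
      (Lp.coeFn_add h₁ h₂)] with ξ hξ
    rw [hξ, Pi.add_apply, Pi.add_apply, mul_add]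
  map_smul' c h := by
    rw [RingHom.id_apply, ← MemLp.toLp_const_smul]
    refine MemLp.toLp_congr _ _ ?_
    filter_upwards [(quasiMeasurePreserving_fst_hyperplaneSplit_symm n).ae
      (Lp.coeFn_smul c h)] with ξ hξ
    rw [hξ, Pi.smul_apply, Pi.smul_apply, smul_eq_mul, smul_eq_mul, mul_left_comm]
  norm_map' h := by
    simp only [LinearMap.coe_mk, AddHom.coe_mk]
    rw [Lp.norm_toLp, eLpNorm_poissonKernel_mul n hlam (Lp.aestronglyMeasurable h), Lp.norm_def]

theorem coeFn_poissonIsometry (n : ℕ) {lam : ℝ} (hlam : lam < 0) (h : L2 n) :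
    poissonIsometry n hlam h =ᵐ[volume]
      fun ξ => (poissonKernel n lam ξ : ℂ) * h ((hyperplaneSplit n).symm ξ).1 :=
  MemLp.coeFn_toLp (memLp_poissonKernel_mul n hlam (Lp.memLp h))

/-- The weight E^{1/2} on ℝⁿ⁺¹ cancels against the denominator of the kernel. What is left is the
integral of the Fourier transform of `f` over `t`, that is, the Fourier transform of the
restriction. This identifies the adjoint of the isometry with √2 times the trace on Schwartz
functions. -/
theorem inner_poissonIsometry_ofSchwartz (n : ℕ) {lam : ℝ} (hlam : lam < 0) (h : L2 n)
    (f : 𝓢(E (n + 1), ℂ)) :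
    inner ℂ (poissonIsometry n hlam h) (energyTransform (n + 1) hlam 1 (Sobolev.ofSchwartz _ 1 f)) =
      (√2 : ℂ) * inner ℂ h (energyTransform n hlam (1 / 2)
        (Sobolev.ofSchwartz n (1 / 2) (restrictHyperplane n f))) := by
  have hae : (fun ξ => inner ℂ (poissonIsometry n hlam h ξ)
      (energyTransform (n + 1) hlam 1 (Sobolev.ofSchwartz _ 1 f) ξ)) =ᵐ[volume]
      fun ξ => (√2 * energySymbol n lam ((hyperplaneSplit n).symm ξ).1 ^ (1 / 4 : ℝ) : ℝ) *
        conj (h ((hyperplaneSplit n).symm ξ).1) * (𝓕 f : 𝓢(E (n + 1), ℂ)) ξ := by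
    filter_upwards [coeFn_poissonIsometry n hlam h,
      coeFn_energyTransform (n + 1) hlam 1 (Sobolev.ofSchwartz _ 1 f),
      Sobolev.fourier_ofSchwartz (s := 1) f] with ξ h1 h2 h3
    have h4 : energySymbol (n + 1) lam ξ ^ (1 / 2 : ℝ) ≠ 0 :=
      (Real.rpow_pos_of_pos (energySymbol_pos _ hlam ξ) _).ne'
    rw [h1, h2, h3, RCLike.inner_apply, map_mul, Complex.conj_ofReal, poissonKernel]
    push_cast
    have h5 : ((energySymbol (n + 1) lam ξ ^ (1 / 2 : ℝ) : ℝ) : ℂ) ≠ 0 :=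
      Complex.ofReal_ne_zero.mpr h4
    field_simp
  rw [L2.inner_def, L2.inner_def, integral_congr_ae hae,
    integral_hyperplaneSplit ((integrable_congr hae).mp (L2.integrable_inner _ _)),
    ← integral_const_mul]
  refine integral_congr_ae ?_
  filter_upwards [coeFn_energyTransform n hlam (1 / 2)
    (Sobolev.ofSchwartz n (1 / 2) (restrictHyperplane n f)),
    Sobolev.fourier_ofSchwartz (s := 1 / 2) (restrictHyperplane n f)] with k h1 h2
  simp only [MeasurableEquiv.symm_apply_apply]
  rw [integral_const_mul, h1, h2, fourier_restrictHyperplane, RCLike.inner_apply,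
    show (1 / 2 / 2 : ℝ) = 1 / 4 by norm_num]
  push_cast
  ring

/-! ### The trace operator and its right inverse -/

/-- The right-hand side is bounded and agrees with restriction on the dense set of Schwartz
functions. Its boundedness is the trace estimate that `extendOfNorm` needs. -/
theorem trace_eq (n : ℕ) {lam : ℝ} (hlam : lam < 0) :
    trace n = (energyTransform n hlam (1 / 2)).symm.toContinuousLinearMap ∘L
      ((√2 : ℂ)⁻¹ • (poissonIsometry n hlam).toContinuousLinearMap.adjoint) ∘L
        (energyTransform (n + 1) hlam 1).toContinuousLinearMap := by
  set g := (energyTransform n hlam (1 / 2)).symm.toContinuousLinearMap ∘L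
      ((√2 : ℂ)⁻¹ • (poissonIsometry n hlam).toContinuousLinearMap.adjoint) ∘L
        (energyTransform (n + 1) hlam 1).toContinuousLinearMap with hg
  have h2 : (√2 : ℂ) ≠ 0 := Complex.ofReal_ne_zero.mpr (by positivity)
  have key (f : 𝓢(E (n + 1), ℂ)) : g (Sobolev.ofSchwartz (n + 1) 1 f) =
      Sobolev.ofSchwartz n (1 / 2) (restrictHyperplane n f) := by
    apply (energyTransform n hlam (1 / 2)).injective
    refine ext_inner_left ℂ fun h => ?_
    simp only [hg, ContinuousLinearMap.comp_apply, ContinuousLinearEquiv.coe_coe,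
      ContinuousLinearEquiv.apply_symm_apply, smul_apply, inner_smul_right,
      ContinuousLinearMap.adjoint_inner_right]
    rw [LinearIsometry.coe_toContinuousLinearMap, inner_poissonIsometry_ofSchwartz,
      inv_mul_cancel_left₀ h2]
  refine LinearMap.extendOfNorm_unique (Sobolev.denseRange_ofSchwartz (n + 1) 1) ‖g‖
    (fun f => ?_) g (LinearMap.ext key)
  exact (congrArg norm (key f)).symm.le.trans (g.le_opNorm _)

/-- The operator `H^{1/2}(ℝⁿ) → H¹(ℝⁿ⁺¹)` whose value at `φ` is the solution `u` of
`-Δu = lam u` away from the hyperplane with trace `φ`. -/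
def poissonOp (n : ℕ) {lam : ℝ} (hlam : lam < 0) : HHalf n →L[ℂ] H1 (n + 1) :=
  (energyTransform (n + 1) hlam 1).symm.toContinuousLinearMap ∘L
    ((√2 : ℂ) • (poissonIsometry n hlam).toContinuousLinearMap) ∘L
      (energyTransform n hlam (1 / 2)).toContinuousLinearMap

/-- An isometry satisfies J*J = 1, and the factors √2 and 1/√2 cancel. -/
theorem trace_poissonOp (n : ℕ) {lam : ℝ} (hlam : lam < 0) (φ : HHalf n) :
    trace n (poissonOp n hlam φ) = φ := by
  have h2 : (√2 : ℂ) ≠ 0 := Complex.ofReal_ne_zero.mpr (by positivity)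
  apply (energyTransform n hlam (1 / 2)).injective
  refine ext_inner_left ℂ fun h => ?_
  simp only [trace_eq n hlam, poissonOp, ContinuousLinearMap.comp_apply,
    ContinuousLinearEquiv.coe_coe, ContinuousLinearEquiv.apply_symm_apply,
    smul_apply, inner_smul_right, ContinuousLinearMap.adjoint_inner_right,
    LinearIsometry.coe_toContinuousLinearMap, LinearIsometry.inner_map_map]
  rw [inv_mul_cancel_left₀ h2]

/-- Green's identity. Moving J across the inner product gives J*, which is √2 times the trace; with
the √2 of `poissonOp` this yields the factor 2 of the relativistic form. -/
theorem gradientForm_poissonOp (n : ℕ) {lam : ℝ} (hlam : lam < 0) (φ : HHalf n)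
    (v : H1 (n + 1)) :
    gradientForm (poissonOp n hlam φ) v -
        inner ℂ (H1.toL2 v) ((lam : ℂ) • H1.toL2 (poissonOp n hlam φ)) =
      relativisticKineticForm n hlam φ (trace n v) := by
  have h2 : (√2 : ℂ) * √2 = 2 := by
    rw [← Complex.ofReal_mul, Real.mul_self_sqrt zero_le_two, Complex.ofReal_ofNat]
  have h0 : (√2 : ℂ) ≠ 0 := Complex.ofReal_ne_zero.mpr (by positivity)
  rw [gradientForm_sub_inner hlam, relativisticKineticForm, inner_quarterPower]
  simp only [trace_eq n hlam, poissonOp, ContinuousLinearMap.comp_apply,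
    ContinuousLinearEquiv.coe_coe, ContinuousLinearEquiv.apply_symm_apply,
    smul_apply, inner_smul_right, inner_smul_left,
    ContinuousLinearMap.adjoint_inner_left, LinearIsometry.coe_toContinuousLinearMap, map_inv₀,
    Complex.conj_ofReal]
  rw [← h2]
  field_simp

/-! ### The eigenspaces -/

section FormGraph

variable {m n : ℕ} {V : Type} [AddCommGroup V] [Module ℂ V] {ι : V →ₗ[ℂ] L2 m}
  {T : V →ₗ[ℂ] L2 n} {α : E n → ℝ} {k : V → V → ℂ} {hk : ∀ v, IsLinearMap ℂ fun u => k u v}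
  {A : L2 m →ₗ.[ℂ] L2 m}

theorem mem_kerSub_iff_mem_graph (A : L2 m →ₗ.[ℂ] L2 m) (μ : ℂ) (x : L2 m) :
    x ∈ kerSub A μ ↔ (x, μ • x) ∈ A.graph := by
  rw [mem_kerSub_iff, LinearPMap.mem_graph_iff]
  constructor
  · rintro ⟨h, e⟩
    exact ⟨⟨x, h⟩, rfl, e⟩
  · rintro ⟨⟨y, h⟩, rfl, e⟩
    exact ⟨h, e⟩

theorem mem_kerSub_iff_of_graph_eq (hA : A.graph = formGraph ι T α k hk)
    (hι : Function.Injective ι) (μ : ℂ) (u : V) :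
    ι u ∈ kerSub A μ ↔ ∀ v : V, Integrable (potentialDensity α (T u) (T v)) ∧
      k u v - ∫ x, potentialDensity α (T u) (T v) x = inner ℂ (ι v) (μ • ι u) := by
  rw [mem_kerSub_iff_mem_graph, hA]
  constructor
  · rintro ⟨w, hw, h⟩
    obtain rfl := hι hw
    exact h
  · exact fun h => ⟨u, rfl, h⟩

theorem kerSub_le_range_of_graph_eq (hA : A.graph = formGraph ι T α k hk) (μ : ℂ) :
    kerSub A μ ≤ LinearMap.range ι := by
  intro x hx
  rw [mem_kerSub_iff_mem_graph, hA] at hx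
  obtain ⟨w, hw, -⟩ := hx
  exact ⟨w, hw⟩

/-- The kernel lies in the range of `ι`, so pulling it back to the form domain loses nothing. -/
theorem rank_comap_kerSub_of_graph_eq (hA : A.graph = formGraph ι T α k hk)
    (hι : Function.Injective ι) (μ : ℂ) :
    Module.rank ℂ ((kerSub A μ).comap ι) = Module.rank ℂ (kerSub A μ) := by
  rw [(Submodule.equivMapOfInjective ι hι ((kerSub A μ).comap ι)).rank_eq,
    Submodule.map_comap_eq_of_le (kerSub_le_range_of_graph_eq hA μ)]

end FormGraph

theorem toL2_mem_kerSub_schrodingerOp_iff {n : ℕ} {α : E n → ℝ} {lam : ℝ} {u : H1 (n + 1)} :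
    H1.toL2 u ∈ kerSub (schrodingerOp n α) (lam : ℂ) ↔ ∀ v : H1 (n + 1),
      Integrable (potentialDensity α (HHalf.toL2 (trace n u)) (HHalf.toL2 (trace n v))) ∧
      gradientForm u v - inner ℂ (H1.toL2 v) ((lam : ℂ) • H1.toL2 u) =
        ∫ x, potentialDensity α (HHalf.toL2 (trace n u)) (HHalf.toL2 (trace n v)) x := by
  rw [mem_kerSub_iff_of_graph_eq (graph_schrodingerOp n α) (Sobolev.toL2_injective _)]
  refine forall_congr' fun v => and_congr_right fun _ => ?_
  exact sub_eq_iff_eq_add.trans (sub_eq_iff_eq_add'.trans Iff.rfl).symm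

theorem toL2_mem_kerSub_relativisticOp_iff {n : ℕ} {α : E n → ℝ} {lam : ℝ} {hlam : lam < 0}
    {φ : HHalf n} :
    HHalf.toL2 φ ∈ kerSub (relativisticOp n α hlam) 0 ↔ ∀ ψ : HHalf n,
      Integrable (potentialDensity α (HHalf.toL2 φ) (HHalf.toL2 ψ)) ∧
      relativisticKineticForm n hlam φ ψ =
        ∫ x, potentialDensity α (HHalf.toL2 φ) (HHalf.toL2 ψ) x := by
  rw [mem_kerSub_iff_of_graph_eq (graph_relativisticOp n α hlam) (Sobolev.toL2_injective _)]
  refine forall_congr' fun ψ => and_congr_right fun _ => ?_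
  rw [zero_smul, inner_zero_right, sub_eq_zero]

/-- The difference `w` has trace zero and is energy-orthogonal to both of its terms, hence to
itself. -/
theorem poissonOp_trace {n : ℕ} {α : E n → ℝ} {lam : ℝ} (hlam : lam < 0) {u : H1 (n + 1)}
    (hu : H1.toL2 u ∈ kerSub (schrodingerOp n α) (lam : ℂ)) :
    poissonOp n hlam (trace n u) = u := by
  rw [toL2_mem_kerSub_schrodingerOp_iff] at hu
  set w := u - poissonOp n hlam (trace n u) with hw
  have hτ : trace n w = 0 := by rw [hw, map_sub, trace_poissonOp, sub_self]
  have h1 : inner ℂ (energyTransform (n + 1) hlam 1 w) (energyTransform (n + 1) hlam 1 u) = 0 := by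
    -- The eigenvalue equation is tested with `w`; the potential only sees the trace of `w`.
    rw [← gradientForm_sub_inner, (hu w).2, hτ, map_zero]
    simp [potentialDensity]
  have h2 : inner ℂ (energyTransform (n + 1) hlam 1 w)
      (energyTransform (n + 1) hlam 1 (poissonOp n hlam (trace n u))) = 0 := by
    rw [← gradientForm_sub_inner, gradientForm_poissonOp, hτ, relativisticKineticForm, map_zero,
      inner_zero_left, mul_zero]
  have h3 : energyTransform (n + 1) hlam 1 w = 0 := by
    rw [← inner_self_eq_zero (𝕜 := ℂ)]
    calc _ = inner ℂ (energyTransform (n + 1) hlam 1 w) (energyTransform (n + 1) hlam 1 u -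
          energyTransform (n + 1) hlam 1 (poissonOp n hlam (trace n u))) := by rw [← map_sub]
      _ = 0 := by rw [inner_sub_right, h1, h2, sub_zero]
  have h4 : w = 0 := (energyTransform (n + 1) hlam 1).injective (by rw [h3, map_zero])
  exact (sub_eq_zero.mp h4).symm

/-- The trace maps the eigenspace of `A_α` at `lam` bijectively onto the kernel of `D_{α,lam}`.
As the trace is onto `H^{1/2}`, the existence of the potential integrals passes from one form to
the other; the integrability of `α` is needed only for the two operators to be self-adjoint. -/
theorem bijOn_trace {n : ℕ} (α : E n → ℝ) {lam : ℝ} (hlam : lam < 0) :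
    Set.BijOn (trace n)
      {u : H1 (n + 1) | H1.toL2 u ∈ kerSub (schrodingerOp n α) (lam : ℂ)}
      {φ : HHalf n | HHalf.toL2 φ ∈ kerSub (relativisticOp n α hlam) 0} := by
  refine ⟨fun u hu => ?_, fun u hu v hv h => ?_, fun φ hφ => ?_⟩
  · have hP := poissonOp_trace hlam hu
    rw [Set.mem_ofPred_eq, toL2_mem_kerSub_schrodingerOp_iff] at hu
    refine toL2_mem_kerSub_relativisticOp_iff.mpr fun ψ => ?_
    -- Every `ψ` is the trace of its Poisson extension, so these test functions yield all of the
    -- equation for the trace of `u`.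
    have := hu (poissonOp n hlam ψ)
    rw [← hP, gradientForm_poissonOp] at this
    simpa only [trace_poissonOp] using this
  · rw [← poissonOp_trace hlam hu, ← poissonOp_trace hlam hv, h]
  · refine ⟨poissonOp n hlam φ, ?_, trace_poissonOp n hlam φ⟩
    rw [Set.mem_ofPred_eq, toL2_mem_kerSub_relativisticOp_iff] at hφ
    refine toL2_mem_kerSub_schrodingerOp_iff.mpr fun v => ?_
    rw [gradientForm_poissonOp, trace_poissonOp]
    exact hφ (trace n v)

/-- The trace acts between Sobolev spaces while the kernels lie in L², so the ranks are compared on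
the pulled-back kernels, where the bijection is linear. -/
theorem rank_kerSub_eq {n : ℕ} (α : E n → ℝ) {lam : ℝ} (hlam : lam < 0) :
    Module.rank ℂ (kerSub (schrodingerOp n α) (lam : ℂ)) =
      Module.rank ℂ (kerSub (relativisticOp n α hlam) 0) := by
  have hb := bijOn_trace α hlam
  rw [← rank_comap_kerSub_of_graph_eq (graph_schrodingerOp n α) (Sobolev.toL2_injective _),
    ← rank_comap_kerSub_of_graph_eq (graph_relativisticOp n α hlam) (Sobolev.toL2_injective _)]
  refine LinearEquiv.lift_rank_eq (LinearEquiv.ofBijective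
    ((trace n).toLinearMap.restrict fun u hu => hb.mapsTo hu) ?_) |> Cardinal.lift_injective
  exact hb.bijective

end DeltaHyperplane

end

/-- Here d = n + 1. Elements of the kernels are represented by their unique preimages in the form
domains, on which the trace is defined. -/
theorem proposition3p2 (n : ℕ) (p : ℝ≥0∞)
    (hp : (n = 1 ∧ 1 < p) ∨ (2 ≤ n ∧ (n : ℝ≥0∞) ≤ p)) (hp_top : p ≠ ∞)
    (α : DeltaHyperplane.E n → ℝ)
    (hα : ∃ β γ : DeltaHyperplane.E n → ℝ,
      MemLp β p volume ∧ MemLp γ ∞ volume ∧ α = β + γ)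
    (lam : ℝ) (hlam : lam < 0) :
    Set.BijOn (DeltaHyperplane.trace n)
      {u : DeltaHyperplane.H1 (n + 1) | DeltaHyperplane.H1.toL2 u ∈
        DeltaHyperplane.kerSub (DeltaHyperplane.schrodingerOp n α) (lam : ℂ)}
      {φ : DeltaHyperplane.HHalf n | DeltaHyperplane.HHalf.toL2 φ ∈
        DeltaHyperplane.kerSub (DeltaHyperplane.relativisticOp n α hlam) 0} ∧
    Module.rank ℂ (DeltaHyperplane.kerSub (DeltaHyperplane.schrodingerOp n α) (lam : ℂ)) =
      Module.rank ℂ (DeltaHyperplane.kerSub (DeltaHyperplane.relativisticOp n α hlam) 0) :=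
  ⟨DeltaHyperplane.bijOn_trace α hlam, DeltaHyperplane.rank_kerSub_eq α hlam⟩
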